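/- Let $\mathcal X\subseteq\mathbb R^{D_1}$; let $A(x)\in\mathbb R^{M\times K}$, $b(x)\in\mathbb R^K$, $T(x)\in\mathbb R^{I\times K}$, $h(x)\in\mathbb R^I$ be affine in $x\in\mathbb R^{D_1}$ and let $c$ be a convex quadratic function of $x$. Let $S\in\mathbb R^{J\times K}$, $t\in\mathbb R^J$, $L\le K$, and suppose that the uncertainty set $$\Xi=\{\xi\in\mathbb R^K_+ : S\xi=t,\ \xi_1,\dots,\xi_L\in\mathbb Z\}$$ is nonempty and bounded, and that the integer $Q\ge 0$ satisfies $\xi_\ell\in\{0,\dots,2^Q-1\}$ for all $\xi\in\Xi$, $\ell\le L$. Let $P\in\mathbb R^{N\times D_2}$, $R\in\mathbb R^{D_2\times K}$, $r\in\mathbb R^{D_2}$, $W\in\mathbb R^{I\times D_2}$. For $x\in\mathcal X$ let $$Z(x)=\sup_{\xi\in\Xi}\ \|A(x)\xi\|^2+b(x)^\top\xi+c(x)+\mathcal R(x,\xi),\qquad \mathcal R(x,\xi)=\inf_{y\in\mathbb R^{D_2}}\{\|Py\|^2+(R\xi+r)^\top y : T(x)\xi+h(x)\le Wy\},$$ where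 $\|\cdot\|$ is the Euclidean norm. The two-stage robust problem is $\inf_{x\in\mathcal X}Z(x)$. Assume complete recourse (there is $y^+\in\mathbb R^{D_2}$ with $Wy^+>0$ componentwise) and that $P$ has full column rank. Put $G=(P^\top P)^{-1}$, $J'=LQ+J+L$, $K'=2LQ+K+I$, and order the coordinates of $\mathbb R^{K'}$ as $(\chi,\eta,\xi,\theta)\in\mathbb R^{LQ}\times\mathbb R^{LQ}\times\mathbb R^K\times\mathbb R^I$, where $\chi=(\chi_{\ell q})$ with $1\le\ell\le L$, $0\le q<Q$, and likewise $\eta$. Let $\mathcal S\in\mathbb R^{J'\times K'}$ be the matrix of the linear map $$(\chi,\eta,\xi,\theta)\mapsto\Bigl(S\xi,\ \bigl(\xi_\ell-\textstyle\sum_{q=0}^{Q-1}2^{q}\chi_{\ell q}\bigr)_{\ell\le L},\ \chi+\eta\Bigr),\qquad \mathscr t=(t,0,\mathbf e)\in\mathbb R^{J'},$$ with $\mathbf e$ the all-ones vector, and let $\mathcal A(x)=[\,0\ \ 0\ \ A(x)\ \ 0\,]\in\mathbb R^{M\times K'}$, $$\mathscr b(x)=\bigl(0,\ 0,\ b(x)-\tfrac12R^\top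 Gr,\ h(x)+\tfrac12WGr\bigr)\in\mathbb R^{K'}.$$ Let $\mathcal P(x)\in\mathbb S^{K'}$ be the symmetric matrix that vanishes outside its $(\xi,\theta)$-block $$\begin{bmatrix}-\frac14R^\top GR&\frac12\bigl(T(x)+\frac12WGR\bigr)^\top\\ \frac12\bigl(T(x)+\frac12WGR\bigr)&-\frac14WGW^\top\end{bmatrix}.$$ For $\gamma\in\mathbb R^{LQ}$ let $\bar\gamma=(\gamma,0)\in\mathbb R^{K'}$, and let $\mathcal C$ be the cone of copositive matrices, that is, of symmetric $B$ with $v^\top Bv\ge0$ for all $v\ge0$. Consider the copositive program $$\begin{array}{cl}\inf& c(x)-\frac14r^\top Gr+\mathscr t^\top\psi+(\mathscr t\circ\mathscr t)^\top\phi+\tau\\[1mm] \text{s.t.}& x\in\mathcal X,\ \tau\in\mathbb R,\ \psi,\phi\in\mathbb R^{J'},\ \gamma\in\mathbb R^{LQ},\ H\in\mathbb S^{K'}_+,\\[1mm] &\begin{bmatrix}\mathbb I&\mathcal A(x)\\ \mathcal A(x)^\top&H\end{bmatrix}\succeq0,\\[4mm] &\begin{bmatrix}\mathcal S^\top\mathrm{diag}(\phi)\mathcal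 S-H-\mathcal P(x)-\mathrm{diag}(\bar\gamma)&\frac12(\mathcal S^\top\psi-\mathscr b(x)+\bar\gamma)\\ \frac12(\mathcal S^\top\psi-\mathscr b(x)+\bar\gamma)^\top&\tau\end{bmatrix}\in\mathcal C.\end{array}$$ Then the two-stage robust problem is equivalent to this copositive program: for every $x\in\mathcal X$, the optimal value of the copositive program with $x$ fixed equals $Z(x)$. Consequently the two problems have the same optimal value; an $x\in\mathcal X$ is optimal for the two-stage problem if and only if the optimal value of the copositive program does not change when $x$ is fixed; and the $x$-part of every optimal solution of the copositive program is optimal for the two-stage problem. (Optimal values are taken in $[-\infty,\infty]$.) The program has polynomial size: the number of its scalar variables (counting all $K'^2$ entries of $H$) plus the numbers of entries of its two constraint matrices, of orders $M+K'$ and $K'+1$, is at most $16\,(D_1+J+K+L+M+I+LQ+1)^2$. -/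

import Mathlib

open scoped Matrix

noncomputable section

/-- Squared Euclidean norm of a real vector. -/
def sqNorm {m : ℕ} (v : Fin m → ℝ) : ℝ := ‖WithLp.toLp 2 v‖ ^ 2

/-- `c` is a convex quadratic function on `ℝⁿ`. -/
def IsConvexQuadratic {n : ℕ} (c : (Fin n → ℝ) → ℝ) : Prop :=
  ∃ (C : Matrix (Fin n) (Fin n) ℝ) (q : Fin n → ℝ) (c₀ : ℝ),
    C.PosSemidef ∧ ∀ x, c x = x ⬝ᵥ (C *ᵥ x) + q ⬝ᵥ x + c₀

/-- Membership in the cone of copositive matrices: symmetric, with a quadratic form that is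
nonnegative on the nonnegative orthant. -/
def IsCopositive {n : Type*} [Fintype n] (M : Matrix n n ℝ) : Prop :=
  M.IsSymm ∧ ∀ v : n → ℝ, 0 ≤ v → 0 ≤ v ⬝ᵥ (M *ᵥ v)

/-- Data of a two-stage robust quadratic program. The first-stage decision lives in `ℝ^D₁`, the
second-stage decision in `ℝ^D₂`, the uncertain parameter in `ℝ^K` with its first `L` components
integer; `J` is the number of equations describing the uncertainty set, `M` and `N` are the numbers
of rows of `A(x)` and `P`, and `I` is the number of second-stage constraints. -/
structure TwoStage (D₁ D₂ J K L M N I : ℕ) where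
  /-- first-stage feasible set -/
  X : Set (Fin D₁ → ℝ)
  A : (Fin D₁ → ℝ) →ᵃ[ℝ] Matrix (Fin M) (Fin K) ℝ
  b : (Fin D₁ → ℝ) →ᵃ[ℝ] (Fin K → ℝ)
  c : (Fin D₁ → ℝ) → ℝ
  S : Matrix (Fin J) (Fin K) ℝ
  t : Fin J → ℝ
  hLK : L ≤ K
  P : Matrix (Fin N) (Fin D₂) ℝ
  R : Matrix (Fin D₂) (Fin K) ℝ
  r : Fin D₂ → ℝ
  T : (Fin D₁ → ℝ) →ᵃ[ℝ] Matrix (Fin I) (Fin K) ℝ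
  h : (Fin D₁ → ℝ) →ᵃ[ℝ] (Fin I → ℝ)
  W : Matrix (Fin I) (Fin D₂) ℝ

/-- Row index set of the lifted equation system: `J` original equations, `L` binary expansions,
`L * Q` slack equations. -/
abbrev RowIdx (J L Q : ℕ) : Type := Fin J ⊕ Fin L ⊕ (Fin L × Fin Q)

/-- Index set of the lifted vector `(χ, η, ξ, θ)`. -/
abbrev ColIdx (K L Q I : ℕ) : Type := (Fin L × Fin Q) ⊕ (Fin L × Fin Q) ⊕ Fin K ⊕ Fin I

namespace TwoStage

variable {D₁ D₂ J K L M N I : ℕ} (d : TwoStage D₁ D₂ J K L M N I)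

/-- The mixed-integer uncertainty set. -/
def Xi : Set (Fin K → ℝ) :=
  {ξ | 0 ≤ ξ ∧ d.S *ᵥ ξ = d.t ∧ ∀ l : Fin L, ∃ z : ℤ, ξ (Fin.castLE d.hLK l) = z}

/-- `Q` bits suffice for the integer components: they take values in `{0, …, 2 ^ Q - 1}`. -/
def BitBound (Q : ℕ) : Prop :=
  ∀ ξ ∈ d.Xi, ∀ l : Fin L, ∃ n : ℕ, n < 2 ^ Q ∧ ξ (Fin.castLE d.hLK l) = n

/-- Complete recourse. -/
def CompleteRecourse : Prop := ∃ y : Fin D₂ → ℝ, ∀ i, 0 < (d.W *ᵥ y) i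

/-! ### The two-stage problem -/

/-- Optimal value of the second-stage problem. -/
def recourse (x : Fin D₁ → ℝ) (ξ : Fin K → ℝ) : EReal :=
  ⨅ y ∈ {y : Fin D₂ → ℝ | d.T x *ᵥ ξ + d.h x ≤ d.W *ᵥ y},
    ((sqNorm (d.P *ᵥ y) + (d.R *ᵥ ξ + d.r) ⬝ᵥ y : ℝ) : EReal)

/-- Worst-case cost of the first-stage decision `x`. -/
def worstCase (x : Fin D₁ → ℝ) : EReal :=
  ⨆ ξ ∈ d.Xi,
    ((sqNorm (d.A x *ᵥ ξ) + d.b x ⬝ᵥ ξ + d.c x : ℝ) : EReal) + d.recourse x ξ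

/-- Optimal value of the two-stage problem. -/
def optimalValue : EReal := ⨅ x ∈ d.X, d.worstCase x

/-! ### The data of the copositive program -/

/-- The matrix `(PᵀP)⁻¹`. -/
def G : Matrix (Fin D₂) (Fin D₂) ℝ := (d.Pᵀ * d.P)⁻¹

/-- The lifted equation matrix; its rows encode `S ξ = t`, then
`ξ_l = ∑ q, 2 ^ q * χ_{l,q}`, then `χ + η = 1`. -/
def liftS (Q : ℕ) : Matrix (RowIdx J L Q) (ColIdx K L Q I) ℝ := Matrix.of fun
  | .inl j, .inr (.inr (.inl k)) => d.S j k
  | .inr (.inl l), .inl p => if p.1 = l then -(2 : ℝ) ^ (p.2 : ℕ) else 0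
  | .inr (.inl l), .inr (.inr (.inl k)) => if k = Fin.castLE d.hLK l then 1 else 0
  | .inr (.inr p), .inl p' => if p = p' then 1 else 0
  | .inr (.inr p), .inr (.inl p') => if p = p' then 1 else 0
  | _, _ => 0

/-- The lifted right-hand side `(t, 0, 1)`. -/
def liftT (Q : ℕ) : RowIdx J L Q → ℝ
  | .inl j => d.t j
  | .inr (.inl _) => 0
  | .inr (.inr _) => 1

/-- The lifted matrix `[0 0 A(x) 0]`. -/
def liftA (Q : ℕ) (x : Fin D₁ → ℝ) : Matrix (Fin M) (ColIdx K L Q I) ℝ := Matrix.of fun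
  | i, .inr (.inr (.inl k)) => d.A x i k
  | _, _ => 0

/-- The lifted vector `(0, 0, b(x) - ½ Rᵀ(PᵀP)⁻¹r, h(x) + ½ W(PᵀP)⁻¹r)`. -/
def liftB (Q : ℕ) (x : Fin D₁ → ℝ) : ColIdx K L Q I → ℝ
  | .inl _ => 0
  | .inr (.inl _) => 0
  | .inr (.inr (.inl k)) => (d.b x - (1 / 2 : ℝ) • ((d.Rᵀ * d.G) *ᵥ d.r)) k
  | .inr (.inr (.inr i)) => (d.h x + (1 / 2 : ℝ) • ((d.W * d.G) *ᵥ d.r)) i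

/-- The off-diagonal block `½ (T(x) + ½ W(PᵀP)⁻¹R)`. -/
def crossBlock (x : Fin D₁ → ℝ) : Matrix (Fin I) (Fin K) ℝ :=
  (1 / 2 : ℝ) • (d.T x + (1 / 2 : ℝ) • (d.W * d.G * d.R))

/-- The lifted symmetric matrix coming from the recourse problem; only its `(ξ, θ)` blocks are
nonzero. -/
def liftP (Q : ℕ) (x : Fin D₁ → ℝ) : Matrix (ColIdx K L Q I) (ColIdx K L Q I) ℝ := Matrix.of fun
  | .inr (.inr (.inl k)), .inr (.inr (.inl k')) => (-(1 / 4 : ℝ) • (d.Rᵀ * d.G * d.R)) k k'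
  | .inr (.inr (.inl k)), .inr (.inr (.inr i)) => (d.crossBlock x)ᵀ k i
  | .inr (.inr (.inr i)), .inr (.inr (.inl k)) => d.crossBlock x i k
  | .inr (.inr (.inr i)), .inr (.inr (.inr i')) => (-(1 / 4 : ℝ) • (d.W * d.G * d.Wᵀ)) i i'
  | _, _ => 0

end TwoStage

/-- The decision variables `(x, τ, ψ, φ, γ, H)` of the copositive program. -/
structure CopPoint (D₁ J K L I Q : ℕ) where
  x : Fin D₁ → ℝ
  τ : ℝ
  ψ : RowIdx J L Q → ℝ
  φ : RowIdx J L Q → ℝ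
  γ : Fin L × Fin Q → ℝ
  H : Matrix (ColIdx K L Q I) (ColIdx K L Q I) ℝ

/-- Size of the copositive program: the number of scalar decision variables plus the numbers of
entries of the matrices in the positive semidefinite constraint and in the copositive constraint. -/
def copSize (D₁ J K L M I Q : ℕ) : ℕ :=
  (D₁ + 1 + 2 * Fintype.card (RowIdx J L Q) + Fintype.card (Fin L × Fin Q)
      + Fintype.card (ColIdx K L Q I × ColIdx K L Q I))
    + Fintype.card ((Fin M ⊕ ColIdx K L Q I) × (Fin M ⊕ ColIdx K L Q I))
    + Fintype.card ((ColIdx K L Q I ⊕ Unit) × (ColIdx K L Q I ⊕ Unit))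

namespace CopPoint

variable {D₁ J K L I Q : ℕ}

/-- The vector `(γ, 0)`. -/
def padγ (p : CopPoint D₁ J K L I Q) : ColIdx K L Q I → ℝ := Sum.elim p.γ 0

end CopPoint

namespace TwoStage

variable {D₁ D₂ J K L M N I : ℕ} (d : TwoStage D₁ D₂ J K L M N I)

/-- The matrix in the copositive constraint. -/
def copMatrix {Q : ℕ} (p : CopPoint D₁ J K L I Q) :
    Matrix (ColIdx K L Q I ⊕ Unit) (ColIdx K L Q I ⊕ Unit) ℝ :=
  let u : ColIdx K L Q I → ℝ :=
    (1 / 2 : ℝ) • ((d.liftS Q)ᵀ *ᵥ p.ψ - d.liftB Q p.x + p.padγ)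
  Matrix.fromBlocks
    ((d.liftS Q)ᵀ * Matrix.diagonal p.φ * d.liftS Q - p.H - d.liftP Q p.x
      - Matrix.diagonal p.padγ)
    (Matrix.replicateCol Unit u)
    (Matrix.replicateRow Unit u)
    (Matrix.of fun _ _ => p.τ)

/-- Feasibility in the copositive program. -/
structure CopFeasible {Q : ℕ} (p : CopPoint D₁ J K L I Q) : Prop where
  mem : p.x ∈ d.X
  psd_H : p.H.PosSemidef
  psd : (Matrix.fromBlocks 1 (d.liftA Q p.x) (d.liftA Q p.x)ᵀ p.H).PosSemidef
  cop : IsCopositive (d.copMatrix p)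

/-- Objective function of the copositive program. -/
def copObjective {Q : ℕ} (p : CopPoint D₁ J K L I Q) : ℝ :=
  d.c p.x - (1 / 4) * (d.r ⬝ᵥ (d.G *ᵥ d.r)) + d.liftT Q ⬝ᵥ p.ψ
    + (d.liftT Q * d.liftT Q) ⬝ᵥ p.φ + p.τ

/-- Optimal value of the copositive program. -/
def copValue (Q : ℕ) : EReal :=
  ⨅ p ∈ {p : CopPoint D₁ J K L I Q | d.CopFeasible p}, (d.copObjective p : EReal)

/-- Optimal value of the copositive program with the first-stage decision fixed to `x`. -/
def copValueAt (Q : ℕ) (x : Fin D₁ → ℝ) : EReal :=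
  ⨅ p ∈ {p : CopPoint D₁ J K L I Q | d.CopFeasible p ∧ p.x = x}, (d.copObjective p : EReal)

end TwoStage

end

/-! For fixed `x` and `ξ` the recourse problem is a strictly convex quadratic program, so it equals
the maximum over `θ ≥ 0` of an explicit concave quadratic in `θ` (`exists_primal_eq_dual`). Hence
`Z(x)` is the supremum of one quadratic function of `(ξ, θ)`. Binary expansion of the integer
coordinates turns the domain into the nonnegative solutions of a linear system with binary `χ`
(`exists_lift_of_mem_Xi`, `mem_Xi_of_lift`).

Weak duality (`dualCost_le_copObjective`) evaluates the copositive form at `(z, 1)` for a lifted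
scenario `z`. Strong duality (`exists_copFeasible`) starts from a real `v` above all costs and
homogenizes "`v` minus cost" into a form `f(z, s)`. On the standard simplex, `f` is positive
wherever the lifted system and the binary conditions hold. If `s > 0`, the point is a rescaled
scenario and `v` is strictly larger than its cost. If `s = 0`, boundedness of the uncertainty set
leaves only `θ ≠ 0`, and complete recourse makes the cost form negative there. By compactness, large
multiples of the two violations make `f` positive on the whole simplex. These multiples are the dual
variables, and the objective is exactly `v`. Working with strict bounds `v` avoids any need for
attainment in the copositive program. -/

theorem sqNorm_eq_dotProduct {m : ℕ} (v : Fin m → ℝ) : sqNorm v = v ⬝ᵥ v := by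
  rw [sqNorm, EuclideanSpace.real_norm_sq_eq]
  simp [dotProduct, sq]

/-! ### Compactness, penalties and homogeneity on the simplex -/

/-- A continuous function that is positive where a nonnegative penalty vanishes becomes positive on
the whole compact set after adding a large multiple of the penalty. -/
theorem IsCompact.exists_penalty {E : Type*} [TopologicalSpace E] {s : Set E} (hs : IsCompact s)
    {f p : E → ℝ} (hf : Continuous f) (hp : Continuous p) (hp0 : ∀ x ∈ s, 0 ≤ p x)
    (hpos : ∀ x ∈ s, p x = 0 → 0 < f x) :
    ∃ ρ : ℝ, 0 ≤ ρ ∧ ∀ x ∈ s, 0 < f x + ρ * p x := by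
  have hc : IsCompact (s ∩ {x | f x ≤ 0}) :=
    hs.inter_right (isClosed_le hf continuous_const)
  rcases (s ∩ {x | f x ≤ 0}).eq_empty_or_nonempty with he | hne
  · refine ⟨0, le_rfl, fun x hx => ?_⟩
    by_contra! h
    have : x ∈ s ∩ {x | f x ≤ 0} := ⟨hx, by simpa using h⟩
    simp [he] at this
  obtain ⟨x₁, h₁, hmin⟩ := hc.exists_isMinOn hne hp.continuousOn
  obtain ⟨x₂, h₂, hmin'⟩ := hc.exists_isMinOn hne hf.continuousOn
  have hm : 0 < p x₁ := lt_of_le_of_ne (hp0 _ h₁.1) fun h =>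
    absurd (hpos _ h₁.1 h.symm) (not_lt.2 h₁.2)
  have hB : 0 ≤ -f x₂ := neg_nonneg.2 h₂.2
  -- With `p x₁` and `f x₂` the minima over the part where `f ≤ 0`, this multiple lifts `f` to at
  -- least `1` there.
  refine ⟨(-f x₂ + 1) / p x₁, by positivity, fun x hx => ?_⟩
  have hρ : 0 ≤ (-f x₂ + 1) / p x₁ := by positivity
  by_cases hfx : f x ≤ 0
  · have h1 : p x₁ ≤ p x := hmin ⟨hx, hfx⟩
    have h2 : f x₂ ≤ f x := hmin' ⟨hx, hfx⟩
    have h3 := mul_le_mul_of_nonneg_left h1 hρ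
    rw [div_mul_cancel₀ _ hm.ne'] at h3
    linarith
  · have := mul_nonneg hρ (hp0 x hx)
    push Not at hfx
    linarith

theorem exists_smul_mem_stdSimplex {ι : Type*} [Fintype ι] {v : ι → ℝ} (hv : 0 ≤ v)
    (hv0 : v ≠ 0) : ∃ σ : ℝ, 0 < σ ∧ σ = ∑ i, v i ∧ ∃ w ∈ stdSimplex ℝ ι, v = σ • w := by
  have hσ : 0 < ∑ i, v i := by
    refine lt_of_le_of_ne (Finset.sum_nonneg fun i _ => hv i) fun h => hv0 ?_
    ext i
    exact (Finset.sum_eq_zero_iff_of_nonneg fun i _ => hv i).1 h.symm i (Finset.mem_univ i)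
  refine ⟨_, hσ, rfl, (∑ i, v i)⁻¹ • v, ⟨fun i => ?_, ?_⟩, ?_⟩
  · exact mul_nonneg (inv_nonneg.2 hσ.le) (hv i)
  · simp only [Pi.smul_apply, smul_eq_mul]
    rw [← Finset.mul_sum, inv_mul_cancel₀ hσ.ne']
  · rw [smul_inv_smul₀ hσ.ne']

theorem dotProduct_mulVec_smul_smul {ι : Type*} [Fintype ι] (B : Matrix ι ι ℝ) (σ : ℝ)
    (w : ι → ℝ) : (σ • w) ⬝ᵥ (B *ᵥ (σ • w)) = σ ^ 2 * (w ⬝ᵥ (B *ᵥ w)) := by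
  simp only [Matrix.mulVec_smul, dotProduct_smul, smul_dotProduct, smul_eq_mul]; ring

/-- A quadratic form that is positive on the standard simplex is copositive. -/
theorem isCopositive_of_stdSimplex {ι : Type*} [Fintype ι] {B : Matrix ι ι ℝ} (hB : B.IsSymm)
    (h : ∀ w ∈ stdSimplex ℝ ι, 0 < w ⬝ᵥ (B *ᵥ w)) : IsCopositive B := by
  refine ⟨hB, fun v hv => ?_⟩
  by_cases hv0 : v = 0
  · simp [hv0]
  obtain ⟨σ, -, -, w, hw, rfl⟩ := exists_smul_mem_stdSimplex hv hv0
  rw [dotProduct_mulVec_smul_smul]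
  exact mul_nonneg (sq_nonneg _) (h w hw).le

/-- A linear function minus a quadratic form that is strictly copositive attains its maximum on the
nonnegative orthant. -/
theorem exists_max_orthant {ι : Type*} [Fintype ι] (B : Matrix ι ι ℝ) (l : ι → ℝ)
    (hB : ∀ v : ι → ℝ, 0 ≤ v → v ≠ 0 → 0 < v ⬝ᵥ (B *ᵥ v)) :
    ∃ θ : ι → ℝ, 0 ≤ θ ∧ ∀ v : ι → ℝ, 0 ≤ v →
      l ⬝ᵥ v - v ⬝ᵥ (B *ᵥ v) ≤ l ⬝ᵥ θ - θ ⬝ᵥ (B *ᵥ θ) := by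
  have hcl : Continuous fun v : ι → ℝ => l ⬝ᵥ v := by fun_prop
  have hcq : Continuous fun v : ι → ℝ => v ⬝ᵥ (B *ᵥ v) := by fun_prop
  have hne : ∀ w ∈ stdSimplex ℝ ι, w ≠ 0 := by
    rintro w hw rfl
    simpa using hw.2
  -- The form has no zero on the simplex, so this gives `l ⬝ᵥ w < ρ * (w ⬝ᵥ B *ᵥ w)` there. At `σ •
  -- w` with `σ > ρ` the objective is then negative, below its value at `0`, so only total mass at
  -- most `ρ` matters.
  obtain ⟨ρ, hρ, hpen⟩ := (isCompact_stdSimplex ℝ ι).exists_penalty hcl.neg hcq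
    (fun w hw => (hB w hw.1 (hne w hw)).le)
    (fun w hw h => absurd h (hB w hw.1 (hne w hw)).ne')
  have hK : IsCompact {v : ι → ℝ | 0 ≤ v ∧ ∑ i, v i ≤ ρ} := by
    refine (isCompact_Icc (a := (0 : ι → ℝ)) (b := fun _ => ρ)).of_isClosed_subset ?_ ?_
    · exact (isClosed_le continuous_const continuous_id).inter
        (isClosed_le (f := fun v : ι → ℝ => ∑ i, v i) (by fun_prop) continuous_const)
    · rintro v ⟨h0, hs⟩
      exact ⟨h0, fun i => (Finset.single_le_sum (fun j _ => h0 j) (Finset.mem_univ i)).trans hs⟩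
  obtain ⟨θ, hθ, hmax⟩ := hK.exists_isMaxOn ⟨0, le_rfl, by simpa using hρ⟩
    (hcl.sub hcq).continuousOn
  refine ⟨θ, hθ.1, fun v hv => ?_⟩
  by_cases hvρ : ∑ i, v i ≤ ρ
  · exact hmax (a := v) ⟨hv, hvρ⟩
  push Not at hvρ
  have h0 : l ⬝ᵥ (0 : ι → ℝ) - 0 ⬝ᵥ (B *ᵥ 0) ≤ l ⬝ᵥ θ - θ ⬝ᵥ (B *ᵥ θ) :=
    hmax (a := (0 : ι → ℝ)) ⟨le_rfl, by simpa using hρ⟩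
  rw [dotProduct_zero, zero_dotProduct, sub_zero] at h0
  refine le_trans ?_ h0
  have hv0 : v ≠ 0 := by rintro rfl; simp at hvρ; linarith
  obtain ⟨σ, hσ, hσv, w, hw, rfl⟩ := exists_smul_mem_stdSimplex hv hv0
  rw [← hσv] at hvρ
  rw [dotProduct_mulVec_smul_smul, dotProduct_smul, smul_eq_mul]
  have h1 : 0 < -(l ⬝ᵥ w) + ρ * (w ⬝ᵥ (B *ᵥ w)) := hpen w hw
  have h2 := hB w hw.1 (hne w hw)
  nlinarith [mul_pos hσ h1, mul_pos hσ (mul_pos (sub_pos.2 hvρ) h2)]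

/-- First-order optimality: divide by `ε` and let `ε` tend to `0`. -/
theorem nonpos_of_forall_mul_le_sq_mul {p q : ℝ}
    (h : ∀ ε : ℝ, 0 < ε → ε ≤ 1 → ε * p ≤ ε ^ 2 * q) : p ≤ 0 := by
  by_contra! hp
  have hq : 0 < q := by have := h 1 one_pos le_rfl; linarith
  have hlt : 0 < min 1 (p / (2 * q)) := lt_min one_pos (by positivity)
  have h1 := h _ hlt (min_le_left _ _)
  have h2 : min 1 (p / (2 * q)) * q ≤ p / 2 := by
    have := mul_le_mul_of_nonneg_right (min_le_right 1 (p / (2 * q))) hq.le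
    rwa [show p / (2 * q) * q = p / 2 by field_simp] at this
  nlinarith

theorem mulVec_dotProduct_comm {ι κ : Type*} [Fintype ι] [Fintype κ] (B : Matrix ι κ ℝ)
    (x : κ → ℝ) (y : ι → ℝ) : (B *ᵥ x) ⬝ᵥ y = x ⬝ᵥ (Bᵀ *ᵥ y) := by
  rw [dotProduct_comm, Matrix.dotProduct_mulVec, dotProduct_comm, Matrix.mulVec_transpose]

/-! ### Strong duality for the recourse problem -/

section QuadraticDuality

variable {m n k : ℕ} {P : Matrix (Fin k) (Fin n) ℝ}

theorem posDef_transpose_mul_self (hP : P.rank = n) : (Pᵀ * P).PosDef := by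
  have hinj : Function.Injective P.mulVec := by
    rw [Matrix.mulVec_injective_iff, linearIndependent_iff_card_eq_finrank_span,
      Set.finrank, ← Matrix.rank_eq_finrank_span_cols, hP, Fintype.card_fin]
  have := Matrix.PosDef.conjTranspose_mul_self P hinj
  rwa [Matrix.conjTranspose_eq_transpose_of_trivial] at this

theorem sqNorm_mulVec (P : Matrix (Fin k) (Fin n) ℝ) (y : Fin n → ℝ) :
    sqNorm (P *ᵥ y) = y ⬝ᵥ ((Pᵀ * P) *ᵥ y) := by
  rw [sqNorm_eq_dotProduct, ← Matrix.mulVec_mulVec, mulVec_dotProduct_comm]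

/-- Lagrangian dual objective of `min ‖P y‖² + gᵀ y` subject to `a ≤ W y`. -/
noncomputable def dualObjective (P : Matrix (Fin k) (Fin n) ℝ) (W : Matrix (Fin m) (Fin n) ℝ) (a : Fin m → ℝ)
    (g : Fin n → ℝ) (θ : Fin m → ℝ) : ℝ :=
  a ⬝ᵥ θ - 1 / 4 * ((g - Wᵀ *ᵥ θ) ⬝ᵥ ((Pᵀ * P)⁻¹ *ᵥ (g - Wᵀ *ᵥ θ)))

theorem isSymm_inv_gram (P : Matrix (Fin k) (Fin n) ℝ) : ((Pᵀ * P)⁻¹)ᵀ = (Pᵀ * P)⁻¹ := by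
  rw [Matrix.transpose_nonsing_inv, Matrix.transpose_mul, Matrix.transpose_transpose]

theorem gram_mulVec_inv (hP : P.rank = n) (w : Fin n → ℝ) :
    (Pᵀ * P) *ᵥ ((Pᵀ * P)⁻¹ *ᵥ w) = w := by
  rw [Matrix.mulVec_mulVec, Matrix.mul_nonsing_inv _
    ((Matrix.isUnit_iff_isUnit_det _).1 (posDef_transpose_mul_self hP).isUnit), Matrix.one_mulVec]

/-- Completing the square: the Lagrangian is minimized at `-½ (PᵀP)⁻¹ w` with `w = g - Wᵀθ`, and its
excess at `y` is the squared `P`-distance to that point. -/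
theorem dualObjective_le (hP : P.rank = n) (W : Matrix (Fin m) (Fin n) ℝ) {a : Fin m → ℝ}
    (g : Fin n → ℝ) {θ : Fin m → ℝ} (hθ : 0 ≤ θ) {y : Fin n → ℝ} (hy : a ≤ W *ᵥ y) :
    dualObjective P W a g θ ≤ sqNorm (P *ᵥ y) + g ⬝ᵥ y := by
  set w := g - Wᵀ *ᵥ θ with hw
  have hsq : 0 ≤ sqNorm (P *ᵥ (y + (1 / 2 : ℝ) • ((Pᵀ * P)⁻¹ *ᵥ w))) := by
    unfold sqNorm; positivity
  have hcomm : ((Pᵀ * P)⁻¹ *ᵥ w) ⬝ᵥ ((Pᵀ * P) *ᵥ y) = w ⬝ᵥ y := by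
    rw [dotProduct_comm, mulVec_dotProduct_comm, Matrix.transpose_mul, Matrix.transpose_transpose,
      gram_mulVec_inv hP, dotProduct_comm]
  have hexp : sqNorm (P *ᵥ (y + (1 / 2 : ℝ) • ((Pᵀ * P)⁻¹ *ᵥ w))) =
      sqNorm (P *ᵥ y) + w ⬝ᵥ y + 1 / 4 * (w ⬝ᵥ ((Pᵀ * P)⁻¹ *ᵥ w)) := by
    rw [sqNorm_mulVec, sqNorm_mulVec]
    simp only [Matrix.mulVec_add, Matrix.mulVec_smul, add_dotProduct, dotProduct_add,
      smul_dotProduct, dotProduct_smul, gram_mulVec_inv hP, hcomm, smul_eq_mul]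
    rw [dotProduct_comm y w, dotProduct_comm ((Pᵀ * P)⁻¹ *ᵥ w) w]
    ring
  have hfe : a ⬝ᵥ θ ≤ (W *ᵥ y) ⬝ᵥ θ := dotProduct_le_dotProduct_of_nonneg_right hy hθ
  have hgw : g ⬝ᵥ y = w ⬝ᵥ y + (W *ᵥ y) ⬝ᵥ θ := by
    rw [mulVec_dotProduct_comm, hw, sub_dotProduct, dotProduct_comm y]; ring
  unfold dualObjective
  rw [← hw]
  linarith

/-- Pairing `Wᵀθ` with the recourse vector gives a sum of nonnegative terms, not all zero. -/
theorem transpose_mulVec_ne_zero {W : Matrix (Fin m) (Fin n) ℝ}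
    (hW : ∃ y : Fin n → ℝ, ∀ i, 0 < (W *ᵥ y) i) {θ : Fin m → ℝ} (hθ : 0 ≤ θ) (h0 : θ ≠ 0) :
    Wᵀ *ᵥ θ ≠ 0 := by
  intro h
  obtain ⟨y, hy⟩ := hW
  have h1 : (W *ᵥ y) ⬝ᵥ θ = 0 := by rw [mulVec_dotProduct_comm, h, dotProduct_zero]
  apply h0
  ext i
  have h2 := (Finset.sum_eq_zero_iff_of_nonneg
    (fun i _ => mul_nonneg (hy i).le (hθ i))).1 h1 i (Finset.mem_univ i)
  exact (mul_eq_zero.1 h2).resolve_left (hy i).ne'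

/-- This strict copositivity serves twice: the dual maximum is attained, and the lifted cost is
negative along recession directions in `θ`. -/
theorem inv_gram_form_pos (hP : P.rank = n) {W : Matrix (Fin m) (Fin n) ℝ}
    (hW : ∃ y : Fin n → ℝ, ∀ i, 0 < (W *ᵥ y) i) {θ : Fin m → ℝ} (hθ : 0 ≤ θ) (h0 : θ ≠ 0) :
    0 < θ ⬝ᵥ ((W * (Pᵀ * P)⁻¹ * Wᵀ) *ᵥ θ) := by
  have h := (posDef_transpose_mul_self hP).inv.dotProduct_mulVec_pos
    (transpose_mulVec_ne_zero hW hθ h0)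
  rwa [star_trivial, mulVec_dotProduct_comm, Matrix.transpose_transpose, Matrix.mulVec_mulVec,
    Matrix.mulVec_mulVec] at h

/-- Strong duality for strictly convex quadratic programs with complete recourse. -/
theorem exists_primal_eq_dual (hP : P.rank = n) {W : Matrix (Fin m) (Fin n) ℝ}
    (hW : ∃ y : Fin n → ℝ, ∀ i, 0 < (W *ᵥ y) i) (a : Fin m → ℝ) (g : Fin n → ℝ) :
    ∃ (y : Fin n → ℝ) (θ : Fin m → ℝ), 0 ≤ θ ∧ a ≤ W *ᵥ y ∧
      sqNorm (P *ᵥ y) + g ⬝ᵥ y = dualObjective P W a g θ := by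
  set G := (Pᵀ * P)⁻¹ with hG
  have hGs : ∀ u v : Fin n → ℝ, u ⬝ᵥ (G *ᵥ v) = v ⬝ᵥ (G *ᵥ u) := fun u v => by
    rw [dotProduct_comm, mulVec_dotProduct_comm, hG, isSymm_inv_gram]
  -- Exact second-order expansion; the gradient at `θ` is `a - W y(θ)`, where `y(θ)` minimizes the
  -- Lagrangian.
  have hstep : ∀ (θ δ : Fin m → ℝ) (ε : ℝ), dualObjective P W a g (θ + ε • δ) =
      dualObjective P W a g θ
        + ε * ((a - W *ᵥ (-(1 / 2 : ℝ) • (G *ᵥ (g - Wᵀ *ᵥ θ)))) ⬝ᵥ δ)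
        - ε ^ 2 * (1 / 4 * (δ ⬝ᵥ ((W * G * Wᵀ) *ᵥ δ))) := by
    intro θ δ ε
    have e1 : g - Wᵀ *ᵥ (θ + ε • δ) = (g - Wᵀ *ᵥ θ) - ε • (Wᵀ *ᵥ δ) := by
      rw [Matrix.mulVec_add, Matrix.mulVec_smul]; abel
    have e2 : δ ⬝ᵥ ((W * G * Wᵀ) *ᵥ δ) = (Wᵀ *ᵥ δ) ⬝ᵥ (G *ᵥ (Wᵀ *ᵥ δ)) := by
      rw [mulVec_dotProduct_comm, Matrix.transpose_transpose, Matrix.mulVec_mulVec,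
        Matrix.mulVec_mulVec]
    unfold dualObjective
    rw [e1, e2, ← hG]
    set w := g - Wᵀ *ᵥ θ
    rw [sub_dotProduct a, mulVec_dotProduct_comm W]
    simp only [Matrix.mulVec_sub, Matrix.mulVec_smul, sub_dotProduct, dotProduct_sub,
      dotProduct_add, smul_dotProduct, dotProduct_smul, smul_eq_mul]
    rw [hGs (Wᵀ *ᵥ δ) w, dotProduct_comm (G *ᵥ w), hGs (Wᵀ *ᵥ δ) w]
    ring
  obtain ⟨θ, hθ, hmax⟩ := exists_max_orthant ((1 / 4 : ℝ) • (W * G * Wᵀ))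
    (a - W *ᵥ (-(1 / 2 : ℝ) • (G *ᵥ g))) (fun v hv hv0 => by
      rw [Matrix.smul_mulVec, dotProduct_smul, smul_eq_mul]
      exact mul_pos (by norm_num) (inv_gram_form_pos hP hW hv hv0))
  have hmax' : ∀ v, 0 ≤ v → dualObjective P W a g v ≤ dualObjective P W a g θ := by
    have hval : ∀ v, dualObjective P W a g v = dualObjective P W a g 0 +
        ((a - W *ᵥ (-(1 / 2 : ℝ) • (G *ᵥ g))) ⬝ᵥ v
          - v ⬝ᵥ (((1 / 4 : ℝ) • (W * G * Wᵀ)) *ᵥ v)) := fun v => by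
      have := hstep 0 v 1
      rw [zero_add, one_smul, Matrix.mulVec_zero, sub_zero] at this
      rw [this, Matrix.smul_mulVec, dotProduct_smul, smul_eq_mul]; ring
    intro v hv
    rw [hval v, hval θ]
    exact add_le_add_right (hmax v hv) _
  set w := g - Wᵀ *ᵥ θ with hw
  set y : Fin n → ℝ := -(1 / 2 : ℝ) • (G *ᵥ w) with hy
  have hdir : ∀ δ : Fin m → ℝ, (∀ ε : ℝ, 0 < ε → ε ≤ 1 → 0 ≤ θ + ε • δ) →
      (a - W *ᵥ y) ⬝ᵥ δ ≤ 0 := fun δ hδ =>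
    nonpos_of_forall_mul_le_sq_mul (q := 1 / 4 * (δ ⬝ᵥ ((W * G * Wᵀ) *ᵥ δ))) fun ε h0 h1 => by
      have e1 := hmax' _ (hδ ε h0 h1)
      rw [hstep] at e1
      linarith
  -- Coordinate directions give primal feasibility; below, the direction `-θ` gives complementary
  -- slackness.
  have hfeas : a ≤ W *ᵥ y := fun i => by
    have := hdir (Pi.single i 1) fun ε h0 _ =>
      add_nonneg hθ (smul_nonneg h0.le (Pi.single_nonneg.2 zero_le_one))
    simpa using this
  have hcs : a ⬝ᵥ θ = (W *ᵥ y) ⬝ᵥ θ := by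
    refine le_antisymm (dotProduct_le_dotProduct_of_nonneg_right hfeas hθ) ?_
    have := hdir (-θ) fun ε _ h1 => by
      have : θ + ε • -θ = (1 - ε) • θ := by module
      rw [this]
      exact smul_nonneg (sub_nonneg.2 h1) hθ
    rw [dotProduct_neg, sub_dotProduct] at this
    linarith
  refine ⟨y, θ, hθ, hfeas, ?_⟩
  have e1 : sqNorm (P *ᵥ y) = 1 / 4 * (w ⬝ᵥ (G *ᵥ w)) := by
    rw [sqNorm_mulVec, hy, dotProduct_mulVec_smul_smul, hG, gram_mulVec_inv hP, dotProduct_comm]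
    ring
  have e2 : g ⬝ᵥ y = -(1 / 2) * (w ⬝ᵥ (G *ᵥ w)) + (W *ᵥ y) ⬝ᵥ θ := by
    have : g = w + Wᵀ *ᵥ θ := by rw [hw]; abel
    rw [mulVec_dotProduct_comm, dotProduct_comm y, this, add_dotProduct, hy, dotProduct_smul,
      smul_eq_mul]
  unfold dualObjective
  rw [← hw, ← hG, e1, e2, hcs]
  ring

end QuadraticDuality

/-- Covers infinite `b` too; for `b = ⊤` the hypothesis is vacuous. -/
theorem EReal.le_coe_of_forall_lt {a b : EReal} (h : ∀ v : ℝ, b < v → a ≤ v) : a ≤ b := by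
  refine le_of_forall_gt_imp_ge_of_dense fun c hc => ?_
  obtain ⟨v, hv, hvc⟩ := EReal.lt_iff_exists_real_btwn.1 hc
  exact (h v hv).trans hvc.le

theorem exists_binary_digits {Q n : ℕ} (hn : n < 2 ^ Q) :
    ∃ f : Fin Q → Fin 2, (n : ℝ) = ∑ q : Fin Q, 2 ^ (q : ℕ) * ((f q : ℕ) : ℝ) := by
  obtain ⟨f, hf⟩ := finFunctionFinEquiv.surjective (⟨n, hn⟩ : Fin (2 ^ Q))
  refine ⟨f, ?_⟩
  have := finFunctionFinEquiv_apply f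
  rw [hf] at this
  rw [show n = _ from this]
  push_cast
  exact Finset.sum_congr rfl fun q _ => mul_comm _ _

/-! ### Algebra of the lifted program -/

section Lift

variable {K L Q I : ℕ}

/-- The lifted vector with the given four parts. -/
def liftVec (χ η : Fin L × Fin Q → ℝ) (ξ : Fin K → ℝ) (θ : Fin I → ℝ) : ColIdx K L Q I → ℝ :=
  Sum.elim χ (Sum.elim η (Sum.elim ξ θ))

theorem exists_liftVec (z : ColIdx K L Q I → ℝ) : ∃ χ η ξ θ, z = liftVec χ η ξ θ :=
  ⟨fun p => z (.inl p), fun p => z (.inr (.inl p)), fun k => z (.inr (.inr (.inl k))),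
    fun i => z (.inr (.inr (.inr i))), by ext (p | p | k | i) <;> rfl⟩

theorem liftVec_nonneg {χ η : Fin L × Fin Q → ℝ} {ξ : Fin K → ℝ} {θ : Fin I → ℝ} :
    0 ≤ liftVec χ η ξ θ ↔ 0 ≤ χ ∧ 0 ≤ η ∧ 0 ≤ ξ ∧ 0 ≤ θ := by
  simp only [Pi.le_def, liftVec, Sum.forall, Pi.zero_apply, Sum.elim_inl, Sum.elim_inr]

end Lift

namespace TwoStage

variable {D₁ D₂ J K L M N I : ℕ} (d : TwoStage D₁ D₂ J K L M N I) {Q : ℕ}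

theorem liftS_mulVec (χ η : Fin L × Fin Q → ℝ) (ξ : Fin K → ℝ) (θ : Fin I → ℝ) :
    d.liftS Q *ᵥ liftVec χ η ξ θ = Sum.elim (d.S *ᵥ ξ)
      (Sum.elim (fun l => ξ (Fin.castLE d.hLK l) - ∑ q : Fin Q, 2 ^ (q : ℕ) * χ (l, q)) (χ + η)) := by
  ext (j | l | p)
  · simp [Matrix.mulVec, dotProduct, liftS, liftVec]
  · simp only [Matrix.mulVec, dotProduct, liftS, liftVec, Matrix.of_apply, Fintype.sum_sum_type,
      Sum.elim_inl, Sum.elim_inr, Fintype.sum_prod_type, ite_mul, zero_mul, one_mul,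
      Finset.sum_const_zero, Finset.sum_ite_eq', Finset.mem_univ, if_true, zero_add, add_zero]
    rw [Finset.sum_comm]
    simp only [Finset.sum_ite_eq', Finset.mem_univ, if_true, neg_mul, Finset.sum_neg_distrib]
    rw [neg_add_eq_sub]
  · simp [Matrix.mulVec, dotProduct, liftS, liftVec]

theorem liftA_mulVec (x : Fin D₁ → ℝ) (χ η : Fin L × Fin Q → ℝ) (ξ : Fin K → ℝ)
    (θ : Fin I → ℝ) : d.liftA Q x *ᵥ liftVec χ η ξ θ = d.A x *ᵥ ξ := by
  ext i
  simp [Matrix.mulVec, dotProduct, liftA, liftVec]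

theorem liftB_dotProduct (x : Fin D₁ → ℝ) (χ η : Fin L × Fin Q → ℝ) (ξ : Fin K → ℝ)
    (θ : Fin I → ℝ) : d.liftB Q x ⬝ᵥ liftVec χ η ξ θ =
      (d.b x - (1 / 2 : ℝ) • ((d.Rᵀ * d.G) *ᵥ d.r)) ⬝ᵥ ξ
        + (d.h x + (1 / 2 : ℝ) • ((d.W * d.G) *ᵥ d.r)) ⬝ᵥ θ := by
  simp [dotProduct, liftB, liftVec]

theorem liftP_mulVec (x : Fin D₁ → ℝ) (χ η : Fin L × Fin Q → ℝ) (ξ : Fin K → ℝ)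
    (θ : Fin I → ℝ) : d.liftP Q x *ᵥ liftVec χ η ξ θ = liftVec 0 0
      ((-(1 / 4 : ℝ) • (d.Rᵀ * d.G * d.R)) *ᵥ ξ + (d.crossBlock x)ᵀ *ᵥ θ)
      (d.crossBlock x *ᵥ ξ + (-(1 / 4 : ℝ) • (d.W * d.G * d.Wᵀ)) *ᵥ θ) := by
  ext (p | p | k | i) <;> simp [Matrix.mulVec, dotProduct, liftP, liftVec]

theorem G_transpose : d.Gᵀ = d.G := isSymm_inv_gram d.P

theorem liftP_transpose (x : Fin D₁ → ℝ) : (d.liftP Q x)ᵀ = d.liftP Q x := by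
  have h1 : (d.Rᵀ * d.G * d.R)ᵀ = d.Rᵀ * d.G * d.R := by
    simp [Matrix.transpose_mul, G_transpose, Matrix.mul_assoc]
  have h2 : (d.W * d.G * d.Wᵀ)ᵀ = d.W * d.G * d.Wᵀ := by
    simp [Matrix.transpose_mul, G_transpose, Matrix.mul_assoc]
  ext (p | p | k | i) (p' | p' | k' | i') <;> try rfl
  · exact congrArg (-(1 / 4 : ℝ) * ·) (congrFun (congrFun h1 k) k')
  · exact congrArg (-(1 / 4 : ℝ) * ·) (congrFun (congrFun h2 i) i')

/-- Expanding the dual quadratic in `g = Rξ + r` explains the data: second-order terms form `liftP`,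
first-order terms correct `b` and `h` in `liftB`, and the constant enters the objective. -/
theorem lift_objective (x : Fin D₁ → ℝ) (χ η : Fin L × Fin Q → ℝ) (ξ : Fin K → ℝ)
    (θ : Fin I → ℝ) :
    liftVec χ η ξ θ ⬝ᵥ (d.liftP Q x *ᵥ liftVec χ η ξ θ) + d.liftB Q x ⬝ᵥ liftVec χ η ξ θ
      - 1 / 4 * (d.r ⬝ᵥ (d.G *ᵥ d.r)) =
    d.b x ⬝ᵥ ξ + dualObjective d.P d.W (d.T x *ᵥ ξ + d.h x) (d.R *ᵥ ξ + d.r) θ := by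
  have hGs : ∀ u v : Fin D₂ → ℝ, u ⬝ᵥ (d.G *ᵥ v) = v ⬝ᵥ (d.G *ᵥ u) := fun u v => by
    rw [dotProduct_comm, mulVec_dotProduct_comm, G_transpose]
  rw [liftB_dotProduct, liftP_mulVec]
  simp only [liftVec, sumElim_dotProduct_sumElim, dotProduct_zero, zero_add]
  unfold dualObjective
  rw [show (d.Pᵀ * d.P)⁻¹ = d.G from rfl]
  have e1 : ξ ⬝ᵥ ((d.crossBlock x)ᵀ *ᵥ θ) = θ ⬝ᵥ (d.crossBlock x *ᵥ ξ) := by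
    rw [← mulVec_dotProduct_comm, dotProduct_comm]
  have e2 : θ ⬝ᵥ (d.crossBlock x *ᵥ ξ) =
      1 / 2 * ((d.T x *ᵥ ξ) ⬝ᵥ θ + 1 / 2 * ((d.R *ᵥ ξ) ⬝ᵥ (d.G *ᵥ (d.Wᵀ *ᵥ θ)))) := by
    rw [crossBlock, Matrix.smul_mulVec, Matrix.add_mulVec, Matrix.smul_mulVec, dotProduct_smul,
      dotProduct_add, dotProduct_smul, ← Matrix.mulVec_mulVec, ← Matrix.mulVec_mulVec,
      dotProduct_comm θ, dotProduct_comm θ, mulVec_dotProduct_comm d.W,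
      dotProduct_comm (d.G *ᵥ _), hGs (d.Wᵀ *ᵥ θ)]
    rfl
  have e3 : ξ ⬝ᵥ ((-(1 / 4 : ℝ) • (d.Rᵀ * d.G * d.R)) *ᵥ ξ) =
      -(1 / 4) * ((d.R *ᵥ ξ) ⬝ᵥ (d.G *ᵥ (d.R *ᵥ ξ))) := by
    rw [Matrix.smul_mulVec, dotProduct_smul, smul_eq_mul, mulVec_dotProduct_comm,
      Matrix.mulVec_mulVec, Matrix.mulVec_mulVec, Matrix.mul_assoc]
  have e4 : θ ⬝ᵥ ((-(1 / 4 : ℝ) • (d.W * d.G * d.Wᵀ)) *ᵥ θ) =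
      -(1 / 4) * ((d.Wᵀ *ᵥ θ) ⬝ᵥ (d.G *ᵥ (d.Wᵀ *ᵥ θ))) := by
    rw [Matrix.smul_mulVec, dotProduct_smul, smul_eq_mul, mulVec_dotProduct_comm d.Wᵀ,
      Matrix.mulVec_mulVec, Matrix.mulVec_mulVec, Matrix.transpose_transpose, Matrix.mul_assoc]
  have e5 : ((d.Rᵀ * d.G) *ᵥ d.r) ⬝ᵥ ξ = (d.R *ᵥ ξ) ⬝ᵥ (d.G *ᵥ d.r) := by
    rw [← Matrix.mulVec_mulVec, mulVec_dotProduct_comm, Matrix.transpose_transpose,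
      dotProduct_comm]
  have e6 : ((d.W * d.G) *ᵥ d.r) ⬝ᵥ θ = d.r ⬝ᵥ (d.G *ᵥ (d.Wᵀ *ᵥ θ)) := by
    rw [← Matrix.mulVec_mulVec, mulVec_dotProduct_comm, dotProduct_comm, ← hGs, dotProduct_comm,
      dotProduct_comm]
  simp only [dotProduct_add, Matrix.mulVec_add, Matrix.mulVec_sub, add_dotProduct, sub_dotProduct,
    dotProduct_sub, smul_dotProduct, smul_eq_mul, e1, e2, e3, e4, e5, e6]
  rw [hGs (d.Wᵀ *ᵥ θ) (d.R *ᵥ ξ), hGs (d.Wᵀ *ᵥ θ) d.r, hGs d.r (d.R *ᵥ ξ)]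
  ring

/-- The quadratic form of the copositive constraint. -/
theorem dotProduct_copMatrix_mulVec (p : CopPoint D₁ J K L I Q) (z : ColIdx K L Q I → ℝ) (s : ℝ) :
    Sum.elim z (fun _ : Unit => s) ⬝ᵥ (d.copMatrix p *ᵥ Sum.elim z fun _ => s) =
      ∑ j, p.φ j * (d.liftS Q *ᵥ z) j ^ 2 - z ⬝ᵥ (p.H *ᵥ z) - z ⬝ᵥ (d.liftP Q p.x *ᵥ z)
        + s * (p.ψ ⬝ᵥ (d.liftS Q *ᵥ z) - d.liftB Q p.x ⬝ᵥ z) + p.τ * s ^ 2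
        + ∑ q, p.γ q * (z (.inl q) * (s - z (.inl q))) := by
  have e1 : z ⬝ᵥ (((d.liftS Q)ᵀ * Matrix.diagonal p.φ * d.liftS Q) *ᵥ z) =
      ∑ j, p.φ j * (d.liftS Q *ᵥ z) j ^ 2 := by
    rw [← Matrix.mulVec_mulVec, ← Matrix.mulVec_mulVec, ← mulVec_dotProduct_comm]
    refine Finset.sum_congr rfl fun j _ => ?_
    rw [Matrix.mulVec_diagonal]; ring
  have e2 : z ⬝ᵥ (Matrix.diagonal p.padγ *ᵥ z) = ∑ q, p.γ q * z (.inl q) ^ 2 := by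
    rw [dotProduct, Fintype.sum_sum_type]
    simp only [Matrix.mulVec_diagonal, CopPoint.padγ, Sum.elim_inl, Sum.elim_inr, Pi.zero_apply,
      zero_mul, mul_zero, Finset.sum_const_zero, add_zero]
    exact Finset.sum_congr rfl fun j _ => by ring
  have e3 : p.padγ ⬝ᵥ z = ∑ q, p.γ q * z (.inl q) := by
    rw [dotProduct, Fintype.sum_sum_type]
    simp [CopPoint.padγ]
  have e4 : ((d.liftS Q)ᵀ *ᵥ p.ψ) ⬝ᵥ z = p.ψ ⬝ᵥ (d.liftS Q *ᵥ z) := by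
    rw [mulVec_dotProduct_comm, Matrix.transpose_transpose]
  have e5 : ∑ q, p.γ q * (z (.inl q) * (s - z (.inl q))) =
      s * ∑ q, p.γ q * z (.inl q) - ∑ q, p.γ q * z (.inl q) ^ 2 := by
    rw [Finset.mul_sum, ← Finset.sum_sub_distrib]
    exact Finset.sum_congr rfl fun j _ => by ring
  have e6 : ∀ u : ColIdx K L Q I → ℝ,
      (Matrix.replicateCol Unit u *ᵥ fun _ => s) = s • u := fun u => by
    ext i; simp [Matrix.mulVec, dotProduct, mul_comm]
  have e7 : ∀ u : ColIdx K L Q I → ℝ,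
      (fun _ : Unit => s) ⬝ᵥ (Matrix.replicateRow Unit u *ᵥ z) = s * (u ⬝ᵥ z) := fun u => by
    simp [Matrix.mulVec, dotProduct]
  have e8 : (fun _ : Unit => s) ⬝ᵥ ((Matrix.of fun _ _ => p.τ) *ᵥ fun _ : Unit => s) =
      p.τ * s ^ 2 := by
    simp [Matrix.mulVec, dotProduct]; ring
  simp only [copMatrix, Matrix.fromBlocks_mulVec, sumElim_dotProduct_sumElim, Sum.elim_comp_inl,
    Sum.elim_comp_inr, dotProduct_add, e6, e7, e8, Matrix.sub_mulVec, dotProduct_sub, e1, e2, e5,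
    dotProduct_smul, smul_eq_mul, smul_dotProduct, add_dotProduct, sub_dotProduct, e3, e4]
  rw [dotProduct_comm z ((d.liftS Q)ᵀ *ᵥ p.ψ), dotProduct_comm z (d.liftB Q p.x),
    dotProduct_comm z p.padγ, e4, e3]
  ring

theorem copMatrix_isSymm {p : CopPoint D₁ J K L I Q} (hH : p.Hᵀ = p.H) :
    (d.copMatrix p).IsSymm := by
  rw [copMatrix, Matrix.isSymm_fromBlocks_iff]
  refine ⟨?_, rfl, rfl, rfl⟩
  simp [Matrix.IsSymm, Matrix.transpose_mul, hH, liftP_transpose, Matrix.mul_assoc]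

/-- Schur complement of the identity block: `H` dominates the Gram matrix of `liftA`. -/
theorem posSemidef_liftA_iff (x : Fin D₁ → ℝ)
    (H : Matrix (ColIdx K L Q I) (ColIdx K L Q I) ℝ) :
    (Matrix.fromBlocks 1 (d.liftA Q x) (d.liftA Q x)ᵀ H).PosSemidef ↔
      (H - (d.liftA Q x)ᵀ * d.liftA Q x).PosSemidef := by
  let : Invertible (1 : Matrix (Fin M) (Fin M) ℝ) := invertibleOne
  have := Matrix.PosDef.fromBlocks₁₁ (d.liftA Q x) H
    (Matrix.PosDef.one : (1 : Matrix (Fin M) (Fin M) ℝ).PosDef)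
  simpa [Matrix.conjTranspose_eq_transpose_of_trivial] using this

theorem dotProduct_liftA_gram (x : Fin D₁ → ℝ) (z : ColIdx K L Q I → ℝ) :
    z ⬝ᵥ (((d.liftA Q x)ᵀ * d.liftA Q x) *ᵥ z) = sqNorm (d.liftA Q x *ᵥ z) := by
  rw [sqNorm_eq_dotProduct, mulVec_dotProduct_comm, Matrix.mulVec_mulVec]

end TwoStage

/-! ### Scenarios, weak duality and strong duality -/

namespace TwoStage

variable {D₁ D₂ J K L M N I : ℕ} (d : TwoStage D₁ D₂ J K L M N I) {Q : ℕ}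

/-- Cost of the scenario `ξ` with the recourse value replaced by the dual objective at `θ`. -/
noncomputable def dualCost (x : Fin D₁ → ℝ) (ξ : Fin K → ℝ) (θ : Fin I → ℝ) : ℝ :=
  sqNorm (d.A x *ᵥ ξ) + d.b x ⬝ᵥ ξ + d.c x
    + dualObjective d.P d.W (d.T x *ᵥ ξ + d.h x) (d.R *ᵥ ξ + d.r) θ

variable {d}

theorem coe_dualObjective_le_recourse (hP : d.P.rank = D₂) (x : Fin D₁ → ℝ) (ξ : Fin K → ℝ)
    {θ : Fin I → ℝ} (hθ : 0 ≤ θ) :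
    (dualObjective d.P d.W (d.T x *ᵥ ξ + d.h x) (d.R *ᵥ ξ + d.r) θ : EReal) ≤ d.recourse x ξ :=
  le_iInf₂ fun _ hy => EReal.coe_le_coe_iff.2 (dualObjective_le hP d.W _ hθ hy)

theorem exists_recourse_le_dualObjective (hP : d.P.rank = D₂) (hrec : d.CompleteRecourse)
    (x : Fin D₁ → ℝ) (ξ : Fin K → ℝ) : ∃ θ : Fin I → ℝ, 0 ≤ θ ∧ d.recourse x ξ ≤
      (dualObjective d.P d.W (d.T x *ᵥ ξ + d.h x) (d.R *ᵥ ξ + d.r) θ : EReal) := by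
  obtain ⟨y, θ, hθ, hy, h⟩ := exists_primal_eq_dual hP hrec (d.T x *ᵥ ξ + d.h x) (d.R *ᵥ ξ + d.r)
  exact ⟨θ, hθ, h ▸ iInf₂_le y hy⟩

theorem coe_dualCost_le_worstCase (hP : d.P.rank = D₂) (x : Fin D₁ → ℝ) {ξ : Fin K → ℝ}
    (hξ : ξ ∈ d.Xi) {θ : Fin I → ℝ} (hθ : 0 ≤ θ) : (d.dualCost x ξ θ : EReal) ≤ d.worstCase x := by
  refine le_trans ?_ (le_iSup₂ (f := fun ξ (_ : ξ ∈ d.Xi) => _) ξ hξ)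
  rw [dualCost, EReal.coe_add]
  exact add_le_add_right (coe_dualObjective_le_recourse hP x ξ hθ) _

/-- With `coe_dualCost_le_worstCase`, this identifies the worst case with the supremum of the dual
costs. -/
theorem worstCase_le (hP : d.P.rank = D₂) (hrec : d.CompleteRecourse) {x : Fin D₁ → ℝ} {v : ℝ}
    (h : ∀ ξ ∈ d.Xi, ∀ θ : Fin I → ℝ, 0 ≤ θ → d.dualCost x ξ θ ≤ v) : d.worstCase x ≤ v := by
  refine iSup₂_le fun ξ hξ => ?_
  obtain ⟨θ, hθ, hle⟩ := exists_recourse_le_dualObjective hP hrec x ξ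
  refine (add_le_add_right hle _).trans ?_
  rw [← EReal.coe_add]
  exact EReal.coe_le_coe_iff.2 (h ξ hξ θ hθ)

theorem dualCost_eq (x : Fin D₁ → ℝ) (χ η : Fin L × Fin Q → ℝ) (ξ : Fin K → ℝ)
    (θ : Fin I → ℝ) : d.dualCost x ξ θ = d.c x - 1 / 4 * (d.r ⬝ᵥ (d.G *ᵥ d.r))
      + sqNorm (d.liftA Q x *ᵥ liftVec χ η ξ θ)
      + liftVec χ η ξ θ ⬝ᵥ (d.liftP Q x *ᵥ liftVec χ η ξ θ)
      + d.liftB Q x ⬝ᵥ liftVec χ η ξ θ := by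
  have := d.lift_objective x χ η ξ θ
  rw [liftA_mulVec, dualCost]
  linarith

/-- The binary expansion lifts every scenario to a binary solution of the lifted system. -/
theorem exists_lift_of_mem_Xi (hQ : d.BitBound Q) {ξ : Fin K → ℝ} (hξ : ξ ∈ d.Xi)
    {θ : Fin I → ℝ} (hθ : 0 ≤ θ) : ∃ χ η : Fin L × Fin Q → ℝ, 0 ≤ liftVec χ η ξ θ ∧
      d.liftS Q *ᵥ liftVec χ η ξ θ = d.liftT Q ∧ ∀ q, χ q * (1 - χ q) = 0 := by
  choose n hn hξn using hQ ξ hξ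
  choose f hf using fun l => exists_binary_digits (hn l)
  have hbin : ∀ a : Fin 2, ((a : ℕ) : ℝ) * (1 - ((a : ℕ) : ℝ)) = 0 ∧ ((a : ℕ) : ℝ) ≤ 1 := by
    intro a; fin_cases a <;> simp
  refine ⟨fun q => ((f q.1 q.2 : ℕ) : ℝ), fun q => 1 - ((f q.1 q.2 : ℕ) : ℝ),
    liftVec_nonneg.2 ⟨fun q => Nat.cast_nonneg _, fun q => sub_nonneg.2 (hbin _).2, hξ.1, hθ⟩,
    ?_, fun q => (hbin _).1⟩
  rw [liftS_mulVec, hξ.2.1]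
  ext (j | l | p)
  · rfl
  · exact sub_eq_zero.2 ((hξn l).trans (hf l))
  · exact add_sub_cancel _ _

/-- A binary solution of the lifted system projects to a scenario. -/
theorem mem_Xi_of_lift {χ η : Fin L × Fin Q → ℝ} {ξ : Fin K → ℝ} {θ : Fin I → ℝ}
    (h0 : 0 ≤ liftVec χ η ξ θ) (hS : d.liftS Q *ᵥ liftVec χ η ξ θ = d.liftT Q)
    (hχ : ∀ q, χ q * (1 - χ q) = 0) : ξ ∈ d.Xi := by
  rw [liftS_mulVec] at hS
  refine ⟨(liftVec_nonneg.1 h0).2.2.1, funext fun j => congrFun hS (.inl j), fun l => ?_⟩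
  have hl : ξ (Fin.castLE d.hLK l) - ∑ q : Fin Q, 2 ^ (q : ℕ) * χ (l, q) = 0 :=
    congrFun hS (.inr (.inl l))
  have hint : ∀ q, ∃ a : ℤ, χ q = a := fun q => by
    rcases mul_eq_zero.1 (hχ q) with h | h
    · exact ⟨0, by simpa using h⟩
    · exact ⟨1, by push_cast; linarith⟩
  choose a ha using hint
  refine ⟨∑ q : Fin Q, 2 ^ (q : ℕ) * a (l, q), ?_⟩
  rw [sub_eq_zero.1 hl]
  push_cast
  exact Finset.sum_congr rfl fun q _ => by rw [ha]

/-- A recession direction of the uncertainty set vanishes. -/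
theorem eq_zero_of_recession (hne : d.Xi.Nonempty) (hbdd : Bornology.IsBounded d.Xi)
    {δ : Fin K → ℝ} (hδ : 0 ≤ δ) (hS : d.S *ᵥ δ = 0) (hint : ∀ l, δ (Fin.castLE d.hLK l) = 0) :
    δ = 0 := by
  obtain ⟨ξ, hξ⟩ := hne
  obtain ⟨C, hC⟩ := hbdd.exists_norm_le
  -- Since `δ` vanishes on the integer coordinates, arbitrary real multiples preserve integrality.
  have hmem : ∀ a : ℝ, 0 ≤ a → ξ + a • δ ∈ d.Xi := fun a ha => by
    refine ⟨add_nonneg hξ.1 (smul_nonneg ha hδ), ?_, fun l => ?_⟩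
    · rw [Matrix.mulVec_add, Matrix.mulVec_smul, hS, smul_zero, add_zero, hξ.2.1]
    · simpa [hint l] using hξ.2.2 l
  ext k
  by_contra hk
  have hpos : 0 < δ k := lt_of_le_of_ne (hδ k) (Ne.symm hk)
  have hC0 : 0 ≤ C := (norm_nonneg ξ).trans (hC ξ hξ)
  have h1 := (norm_le_pi_norm _ k).trans (hC _ (hmem ((C + 1) / δ k) (by positivity)))
  rw [Pi.add_apply, Pi.smul_apply, smul_eq_mul, div_mul_cancel₀ _ hpos.ne'] at h1
  have h2 := (le_abs_self _).trans h1
  have h3 : 0 ≤ ξ k := hξ.1 k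
  linarith

/-- A nonzero nonnegative solution of the homogeneous lifted system has negative objective. -/
theorem lift_form_neg_of_recession (hne : d.Xi.Nonempty) (hbdd : Bornology.IsBounded d.Xi)
    (hrec : d.CompleteRecourse) (hP : d.P.rank = D₂) (x : Fin D₁ → ℝ)
    {z : ColIdx K L Q I → ℝ} (h0 : 0 ≤ z) (hS : d.liftS Q *ᵥ z = 0) (hz : z ≠ 0) :
    sqNorm (d.liftA Q x *ᵥ z) + z ⬝ᵥ (d.liftP Q x *ᵥ z) < 0 := by
  obtain ⟨χ, η, ξ, θ, rfl⟩ := exists_liftVec z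
  obtain ⟨hχ0, hη0, hξ0, hθ0⟩ := liftVec_nonneg.1 h0
  rw [liftS_mulVec] at hS
  have hsum : ∀ q, χ q + η q = 0 := fun q => congrFun hS (.inr (.inr q))
  have hχ : χ = 0 := funext fun q => by
    have h1 : 0 ≤ χ q := hχ0 q
    have h2 : 0 ≤ η q := hη0 q
    have h3 := hsum q
    show χ q = 0
    linarith
  have hη : η = 0 := funext fun q => by simpa [hχ] using hsum q
  have hξ : ξ = 0 := eq_zero_of_recession hne hbdd hξ0 (funext fun j => congrFun hS (.inl j))
    fun l => by simpa [hχ] using congrFun hS (.inr (.inl l))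
  subst hχ hη hξ
  have hθ : θ ≠ 0 := by
    rintro rfl
    exact hz (by ext (p | p | k | i) <;> rfl)
  have hpos := inv_gram_form_pos hP hrec hθ0 hθ
  rw [liftA_mulVec, liftP_mulVec]
  simp only [liftVec, sumElim_dotProduct_sumElim, Matrix.mulVec_zero, zero_dotProduct, zero_add,
    Matrix.smul_mulVec, dotProduct_smul, smul_eq_mul, sqNorm_eq_dotProduct]
  change 0 < θ ⬝ᵥ ((d.W * d.G * d.Wᵀ) *ᵥ θ) at hpos
  linarith

/-- Weak duality: every feasible point of the copositive program bounds the cost of all scenarios. -/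
theorem dualCost_le_copObjective (hQ : d.BitBound Q) {p : CopPoint D₁ J K L I Q}
    (hp : d.CopFeasible p) {ξ : Fin K → ℝ} (hξ : ξ ∈ d.Xi) {θ : Fin I → ℝ} (hθ : 0 ≤ θ) :
    d.dualCost p.x ξ θ ≤ d.copObjective p := by
  obtain ⟨χ, η, h0, hS, hχ⟩ := exists_lift_of_mem_Xi hQ hξ hθ
  rw [dualCost_eq p.x χ η, copObjective]
  set z := liftVec χ η ξ θ with hz
  -- At `(z, 1)` the `γ` terms vanish because `χ` is binary, and the `ψ`, `φ` terms become those of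
  -- the objective because `z` solves the lifted system.
  have hcop := hp.cop.2 (Sum.elim z fun _ => 1) (by rintro (i | i); exacts [h0 i, zero_le_one])
  have hH := ((d.posSemidef_liftA_iff p.x p.H).1 hp.psd).dotProduct_mulVec_nonneg z
  rw [star_trivial, Matrix.sub_mulVec, dotProduct_sub, dotProduct_liftA_gram] at hH
  rw [dotProduct_copMatrix_mulVec, hS] at hcop
  have hγ : ∑ q, p.γ q * (z (.inl q) * (1 - z (.inl q))) = 0 :=
    Finset.sum_eq_zero fun q _ => by
      rw [show z (.inl q) = χ q from rfl, hχ q, mul_zero]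
  have hφ : (d.liftT Q * d.liftT Q) ⬝ᵥ p.φ = ∑ j, p.φ j * d.liftT Q j ^ 2 :=
    Finset.sum_congr rfl fun j _ => by rw [Pi.mul_apply]; ring
  rw [hγ, dotProduct_comm p.ψ] at hcop
  rw [hφ]
  linarith

/-- Strong duality: every strict upper bound on the cost of all scenarios is the objective value of
a feasible point of the copositive program. -/
theorem exists_copFeasible (hne : d.Xi.Nonempty) (hbdd : Bornology.IsBounded d.Xi)
    (hrec : d.CompleteRecourse) (hP : d.P.rank = D₂) {x : Fin D₁ → ℝ} (hx : x ∈ d.X) {v : ℝ}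
    (hv : ∀ ξ ∈ d.Xi, ∀ θ : Fin I → ℝ, 0 ≤ θ → d.dualCost x ξ θ < v) :
    ∃ p : CopPoint D₁ J K L I Q, d.CopFeasible p ∧ p.x = x ∧ d.copObjective p = v := by
  -- Chosen so that `f` at `s • (z, 1)` is `s ^ 2` times `v` minus the cost of `z`.
  set κ : ℝ := v - d.c x + 1 / 4 * (d.r ⬝ᵥ (d.G *ᵥ d.r)) with hκ
  let f : (ColIdx K L Q I ⊕ Unit → ℝ) → ℝ := fun w =>
    κ * w (.inr ()) ^ 2 - (d.liftA Q x *ᵥ (w ∘ Sum.inl)) ⬝ᵥ (d.liftA Q x *ᵥ (w ∘ Sum.inl))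
      - (w ∘ Sum.inl) ⬝ᵥ (d.liftP Q x *ᵥ (w ∘ Sum.inl))
      - w (.inr ()) * (d.liftB Q x ⬝ᵥ (w ∘ Sum.inl))
  let g₁ : (ColIdx K L Q I ⊕ Unit → ℝ) → ℝ := fun w =>
    ∑ j, ((d.liftS Q *ᵥ (w ∘ Sum.inl)) j - w (.inr ()) * d.liftT Q j) ^ 2
  let g₂ : (ColIdx K L Q I ⊕ Unit → ℝ) → ℝ := fun w =>
    ∑ q, w (.inl (.inl q)) * (w (.inr ()) - w (.inl (.inl q)))
  have hf : Continuous f := by fun_prop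
  have hg₁ : Continuous g₁ := by fun_prop
  have hg₂ : Continuous g₂ := by fun_prop
  have hg₁0 : ∀ w, 0 ≤ g₁ w := fun w => Finset.sum_nonneg fun _ _ => sq_nonneg _
  have hsys : ∀ w, g₁ w = 0 → d.liftS Q *ᵥ (w ∘ Sum.inl) = w (.inr ()) • d.liftT Q := fun w hw =>
    funext fun j => sub_eq_zero.1 (pow_eq_zero_iff two_ne_zero |>.1
      ((Finset.sum_eq_zero_iff_of_nonneg fun _ _ => sq_nonneg _).1 hw j (Finset.mem_univ j)))
  -- The slack rows read `χ + η = s`, so `0 ≤ χ ≤ s`. This sign is only available where `g₁ = 0`,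
  -- hence `g₂` is penalized there first and `g₁` on the whole simplex afterwards.
  have hbin0 : ∀ w ∈ stdSimplex ℝ (ColIdx K L Q I ⊕ Unit), g₁ w = 0 → ∀ q,
      0 ≤ w (.inl (.inl q)) * (w (.inr ()) - w (.inl (.inl q))) := fun w hw hw₁ q => by
    have h1 := congrFun (hsys w hw₁) (.inr (.inr q))
    obtain ⟨χ, η, ξ, θ, hz⟩ := exists_liftVec (w ∘ Sum.inl)
    have hχ : w (.inl (.inl q)) = χ q := congrFun hz (.inl q)
    have hη : w (.inl (.inr (.inl q))) = η q := congrFun hz (.inr (.inl q))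
    rw [hz, liftS_mulVec] at h1
    have h2 : χ q + η q = w (.inr ()) * 1 := h1
    have h3 := hw.1 (.inl (.inr (.inl q)))
    refine mul_nonneg (hw.1 _) ?_
    linarith
  obtain ⟨ρ₂, hρ₂, hpen₂⟩ :=
    ((isCompact_stdSimplex ℝ (ColIdx K L Q I ⊕ Unit)).inter_right
      (isClosed_eq hg₁ continuous_const : IsClosed {w | g₁ w = 0})).exists_penalty hf hg₂
      (fun w hw => Finset.sum_nonneg fun q _ => hbin0 w hw.1 hw.2 q)
      (fun w hw hw₂ => by
        have hw0 := hw.1.1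
        have hS := hsys w hw.2
        have hbin : ∀ q, w (.inl (.inl q)) * (w (.inr ()) - w (.inl (.inl q))) = 0 := fun q =>
          (Finset.sum_eq_zero_iff_of_nonneg fun q _ => hbin0 w hw.1 hw.2 q).1 hw₂ q
            (Finset.mem_univ q)
        have hz0 : 0 ≤ w ∘ Sum.inl := fun i => hw0 _
        by_cases hs : w (.inr ()) = 0
        · rw [hs, zero_smul] at hS
          have hz : w ∘ Sum.inl ≠ 0 := fun h => by
            have h1 := hw.1.2
            rw [Fintype.sum_sum_type,
              Finset.sum_eq_zero (f := fun i => w (.inl i)) fun i _ => congrFun h i] at h1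
            simp [hs] at h1
          have := lift_form_neg_of_recession hne hbdd hrec hP x hz0 hS hz
          rw [sqNorm_eq_dotProduct] at this
          simp only [f, hs]
          linarith
        · have hs0 : 0 < w (.inr ()) := lt_of_le_of_ne (hw0 _) (Ne.symm hs)
          simp only [f]
          generalize w (.inr ()) = s at *
          obtain ⟨χ, η, ξ, θ, hz⟩ := exists_liftVec (s⁻¹ • (w ∘ Sum.inl))
          have hz' : w ∘ Sum.inl = s • liftVec χ η ξ θ := by rw [← hz, smul_inv_smul₀ hs]
          have hχ : ∀ q, w (.inl (.inl q)) = s * χ q := fun q => congrFun hz' (.inl q)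
          have hnn : 0 ≤ liftVec χ η ξ θ := hz ▸ smul_nonneg (inv_nonneg.2 hs0.le) hz0
          have hξ : ξ ∈ d.Xi := by
            refine mem_Xi_of_lift (χ := χ) (η := η) hnn ?_ fun q => ?_
            · rw [← hz, Matrix.mulVec_smul, hS, inv_smul_smul₀ hs]
            · have h1 := hbin q
              rw [hχ q] at h1
              have h2 : s ^ 2 * (χ q * (1 - χ q)) = 0 := by rw [← h1]; ring
              exact (mul_eq_zero.1 h2).resolve_left (pow_ne_zero 2 hs)
          have hcost := hv ξ hξ θ (liftVec_nonneg.1 hnn).2.2.2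
          rw [dualCost_eq x χ η, sqNorm_eq_dotProduct] at hcost
          rw [hz']
          simp only [Matrix.mulVec_smul, smul_dotProduct, dotProduct_smul, smul_eq_mul]
          have h3 := mul_pos (pow_pos hs0 2) (sub_pos.2 hcost)
          rw [hκ]
          nlinarith only [h3])
  obtain ⟨ρ₁, hρ₁, hpen₁⟩ :=
    (isCompact_stdSimplex ℝ (ColIdx K L Q I ⊕ Unit)).exists_penalty
      (f := fun w => f w + ρ₂ * g₂ w) (by fun_prop) hg₁ (fun w _ => hg₁0 w)
      fun w hw hw₁ => hpen₂ w ⟨hw, hw₁⟩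
  -- Read off from `f + ρ₂ g₂ + ρ₁ g₁`: expanding the squares in `g₁` yields `φ`, `ψ` and the `ρ₁`
  -- part of `τ`, whose contributions to the objective cancel.
  let p : CopPoint D₁ J K L I Q :=
    { x := x
      τ := ρ₁ * (d.liftT Q ⬝ᵥ d.liftT Q) + κ
      ψ := (-2 * ρ₁) • d.liftT Q
      φ := fun _ => ρ₁
      γ := fun _ => ρ₂
      H := (d.liftA Q x)ᵀ * d.liftA Q x }
  have hH : p.H.PosSemidef := by
    have := Matrix.posSemidef_conjTranspose_mul_self (d.liftA Q x)
    rwa [Matrix.conjTranspose_eq_transpose_of_trivial] at this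
  refine ⟨p, ⟨hx, hH, ?_, ?_⟩, rfl, ?_⟩
  · refine (d.posSemidef_liftA_iff x p.H).2 ?_
    rw [sub_self]
    exact Matrix.PosSemidef.zero
  · refine isCopositive_of_stdSimplex (d.copMatrix_isSymm hH.1) fun w hw => ?_
    have hw' : w = Sum.elim (w ∘ Sum.inl) fun _ => w (.inr ()) := by ext (i | i) <;> rfl
    have hmain := hpen₁ w hw
    rw [hw', dotProduct_copMatrix_mulVec, dotProduct_liftA_gram, sqNorm_eq_dotProduct]
    refine hmain.trans_eq ?_
    have e1 : g₁ w = ∑ j, (d.liftS Q *ᵥ (w ∘ Sum.inl)) j ^ 2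
        - 2 * w (.inr ()) * (d.liftT Q ⬝ᵥ (d.liftS Q *ᵥ (w ∘ Sum.inl)))
        + w (.inr ()) ^ 2 * (d.liftT Q ⬝ᵥ d.liftT Q) := by
      simp only [g₁, dotProduct, Finset.mul_sum, ← Finset.sum_sub_distrib,
        ← Finset.sum_add_distrib]
      exact Finset.sum_congr rfl fun j _ => by ring
    have e2 : ∑ q, p.γ q * ((w ∘ Sum.inl) (.inl q) * (w (.inr ()) - (w ∘ Sum.inl) (.inl q))) =
        ρ₂ * g₂ w := (Finset.mul_sum _ _ _).symm
    have e3 : ∑ j, p.φ j * (d.liftS Q *ᵥ (w ∘ Sum.inl)) j ^ 2 =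
        ρ₁ * ∑ j, (d.liftS Q *ᵥ (w ∘ Sum.inl)) j ^ 2 := (Finset.mul_sum _ _ _).symm
    rw [e1, e2, e3]
    simp only [f, p, smul_dotProduct, smul_eq_mul]
    ring
  · have e1 : (d.liftT Q * d.liftT Q) ⬝ᵥ p.φ = ρ₁ * (d.liftT Q ⬝ᵥ d.liftT Q) := by
      rw [dotProduct, dotProduct, Finset.mul_sum]
      exact Finset.sum_congr rfl fun j _ => by rw [Pi.mul_apply]; ring
    rw [copObjective, e1]
    simp only [p, dotProduct_smul, smul_eq_mul]
    rw [hκ]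
    ring

theorem worstCase_eq_copValueAt (hne : d.Xi.Nonempty) (hbdd : Bornology.IsBounded d.Xi)
    (hQ : d.BitBound Q) (hrec : d.CompleteRecourse) (hP : d.P.rank = D₂) {x : Fin D₁ → ℝ}
    (hx : x ∈ d.X) : d.worstCase x = d.copValueAt Q x := by
  refine le_antisymm (le_iInf₂ ?_) (EReal.le_coe_of_forall_lt fun v hv => ?_)
  · rintro p ⟨hp, rfl⟩
    exact worstCase_le hP hrec fun ξ hξ θ hθ => dualCost_le_copObjective hQ hp hξ hθ
  · obtain ⟨p, hp, hpx, hpv⟩ := exists_copFeasible (Q := Q) hne hbdd hrec hP hx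
      fun ξ hξ θ hθ => EReal.coe_lt_coe_iff.1
        ((coe_dualCost_le_worstCase hP x hξ hθ).trans_lt hv)
    exact hpv ▸ iInf₂_le p ⟨hp, hpx⟩

theorem copValue_eq_iInf_copValueAt : d.copValue Q = ⨅ x ∈ d.X, d.copValueAt Q x :=
  le_antisymm (le_iInf₂ fun _ _ => le_iInf₂ fun p hp => iInf₂_le p hp.1)
    (le_iInf₂ fun p hp => (iInf₂_le p.x hp.mem).trans (iInf₂_le p ⟨hp, rfl⟩))

end TwoStage

/-- With `n` the bracketed sum, the three matrix orders `K'`, `M + K'`, `K' + 1` are at most `2n`,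
giving `12n²`; the remaining variables number at most `3n ≤ 3n²`. -/
theorem copSize_le (D₁ J K L M I Q : ℕ) :
    copSize D₁ J K L M I Q ≤ 16 * (D₁ + J + K + L + M + I + L * Q + 1) ^ 2 := by
  simp only [copSize, Fintype.card_sum, Fintype.card_prod, Fintype.card_fin, Fintype.card_unit]
  generalize L * Q = a
  nlinarith only [Nat.zero_le (D₁ * D₁), sq_nonneg (D₁ + J + K + L + M + I + a + 1)]

theorem mainTheorem4 {D₁ D₂ J K L M N I : ℕ} (d : TwoStage D₁ D₂ J K L M N I) (Q : ℕ)
    (hc : IsConvexQuadratic d.c)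
    (hne : d.Xi.Nonempty)
    (hbdd : Bornology.IsBounded d.Xi)
    (hQ : d.BitBound Q)
    (hrec : d.CompleteRecourse)
    (hP : d.P.rank = D₂) :
    -- for every fixed first-stage decision the worst-case cost is the copositive optimal value
    (∀ x ∈ d.X, d.worstCase x = d.copValueAt Q x) ∧
    -- the two problems have the same optimal value
    d.optimalValue = d.copValue Q ∧
    -- first-stage optimality is the same in both problems
    (∀ x ∈ d.X, d.worstCase x = d.optimalValue ↔ d.copValueAt Q x = d.copValue Q) ∧
    -- the first-stage part of an optimal solution of the copositive program is optimal
    (∀ p : CopPoint D₁ J K L I Q, d.CopFeasible p → (d.copObjective p : EReal) = d.copValue Q →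
      d.worstCase p.x = d.optimalValue) ∧
    -- the size of the copositive program
    Fintype.card (RowIdx J L Q) = L * Q + J + L ∧
    Fintype.card (ColIdx K L Q I) = 2 * (L * Q) + K + I ∧
    copSize D₁ J K L M I Q ≤ 16 * (D₁ + J + K + L + M + I + L * Q + 1) ^ 2 := by
  have hat : ∀ x ∈ d.X, d.worstCase x = d.copValueAt Q x := fun x hx =>
    TwoStage.worstCase_eq_copValueAt hne hbdd hQ hrec hP hx
  have hval : d.optimalValue = d.copValue Q := by
    rw [TwoStage.copValue_eq_iInf_copValueAt]
    exact biInf_congr hat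
  refine ⟨hat, hval, fun x hx => by rw [hat x hx, hval], fun p hp hopt => ?_, ?_, ?_,
    copSize_le ..⟩
  · refine le_antisymm ?_ (iInf₂_le p.x hp.mem)
    rw [hat p.x hp.mem, hval, ← hopt]
    exact iInf₂_le p ⟨hp, rfl⟩
  · simp only [Fintype.card_sum, Fintype.card_prod, Fintype.card_fin]
    ring
  · simp only [Fintype.card_sum, Fintype.card_prod, Fintype.card_fin]
    ring
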